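/- Let $\mathcal X$ be a measurable space. A regression algorithm $\mathcal A$ maps every data set $\big((x_1,y_1),\dots,(x_k,y_k)\big)\in(\mathcal X\times\mathbb R)^k$, $k\ge 0$, to a function $\mathcal X\to\mathbb R$, such that for each $k$ the prediction is jointly measurable in the data set and the test feature; it is symmetric if its output does not depend on the order of the data points. For real numbers $v_1,\dots,v_n$ and $\tau\in\mathbb R$ let $\mathrm{Quantile}(\{v_i\}_{i\in[n]};\tau)=\inf\{t\in\mathbb R:\frac1n\#\{i: v_i\le t\}\ge\tau\}\in[-\infty,\infty]$. Fix $\alpha\in[0,1]$. Given $\mathcal D_n=\big((X_1,Y_1),\dots,(X_n,Y_n)\big)$, let $\widehat\mu_{-i}$ be the output of $\mathcal A$ on $\mathcal D_n$ with the $i$th point removed, let $R_i=|Y_i-\widehat\mu_{-i}(X_i)|$, and for $\gamma>0$ let the $\gamma$-inflated jackknife+ interval be the set of real numbers $$\widehat C_n^{\gamma\text{-J+}}(x)=\Big[-\mathrm{Quantile}\big(\{-\widehat\mu_{-i}(x)+R_i\}_{i\in[n]};(1-\alpha)(1+\tfrac1n)\big)-\gamma,\ \mathrm{Quantile}\big(\{\widehat\mu_{-i}(x)+R_i\}_{i\in[n]};(1-\alpha)(1+\tfrac1n)\big)+\gamma\Big]\cap\mathbb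 R .$$ For a probability distribution $P$ on $\mathcal X\times\mathbb R$, let $\alpha_P^{\gamma\text{-J+}}(\mathcal D_n)=\mathbb P\{Y_{n+1}\notin\widehat C_n^{\gamma\text{-J+}}(X_{n+1})\mid\mathcal D_n\}$ be its training-conditional miscoverage rate, where $(X_{n+1},Y_{n+1})\sim P$ is independent of $\mathcal D_n$. For integers $k,m\ge 0$ define the out-of-sample $m$-stability $$\beta^{\mathrm{out}}_{m,k}=\mathbb E\big[|\widehat\mu_k(X)-\widehat\mu_{k+m}(X)|\big]\in[0,\infty],$$ where $\widehat\mu_k$ and $\widehat\mu_{k+m}$ are the outputs of $\mathcal A$ on the first $k$, respectively on all, of the points $(X_1,Y_1),\dots,(X_{k+m},Y_{k+m})$, and where these points and $(X,Y)$ are i.i.d. from $P$. For every probability distribution $P$ on $\mathcal X\times\mathbb R$, every symmetric algorithm $\mathcal A$, all integers $n,m\ge 1$, every $\gamma>0$ and every $\delta\in(0,1)$, $$\mathbb P\left\{\alpha_P^{\gamma\text{-J+}}(\mathcal D_n)<\alpha+3\sqrt{\frac{\log(1/\delta)}{2\min\{n,m\}}}+2\sqrt[3]{\frac{2\beta^{\mathrm{out}}_{m,n-1}}{\gamma}}\right\}\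 \ge\ 1-3\delta-\sqrt[3]{\frac{2\beta^{\mathrm{out}}_{m,n-1}}{\gamma}},$$ where the probability is taken over $\mathcal D_n=\{(X_i,Y_i)\}_{i\in[n]}$ drawn i.i.d. from $P$. -/

import Mathlib

open MeasureTheory

/-- A (deterministic) regression algorithm: it takes a data set `(X₁,Y₁),…,(Xₙ,Yₙ)` of any size
`n ≥ 0` and returns a fitted regression function `X → ℝ`. The prediction is measurable in the
training data and the test point jointly (so each fitted function is measurable, and
probabilities and expectations of predictions make sense). -/
structure RegressionAlgorithm (X : Type*) [MeasurableSpace X] where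
  /-- `fit n D` is the regression function fitted to the data set `D` of size `n`. -/
  fit : (n : ℕ) → (Fin n → X × ℝ) → X → ℝ
  measurable_fit : ∀ n : ℕ, Measurable fun p : (Fin n → X × ℝ) × X => fit n p.1 p.2

namespace RegressionAlgorithm

variable {X : Type*} [MeasurableSpace X]

/-- The fitted model does not depend on the order of the training data. -/
def IsSymmetric (A : RegressionAlgorithm X) : Prop :=
  ∀ (n : ℕ) (σ : Equiv.Perm (Fin n)) (D : Fin n → X × ℝ),
    A.fit n (fun i => D (σ i)) = A.fit n D

/-- The leave-one-out model: the algorithm is run on the data set with the `i`-th point removed. -/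
def leaveOneOut (A : RegressionAlgorithm X) : {n : ℕ} → (Fin n → X × ℝ) → Fin n → X → ℝ
  | 0, _, i => i.elim0
  | n + 1, D, i => A.fit n (fun j : Fin n => D (i.succAbove j))

/-- The leave-one-out residual `Rᵢ = |Yᵢ - μ₋ᵢ(Xᵢ)|`. -/
def looResidual (A : RegressionAlgorithm X) {n : ℕ} (D : Fin n → X × ℝ) (i : Fin n) : ℝ :=
  |(D i).2 - A.leaveOneOut D i (D i).1|

end RegressionAlgorithm

/-- The `τ`-quantile `inf {t : (1/n) #{i : vᵢ ≤ t} ≥ τ}` of the empirical distribution of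
`v₁,…,vₙ`, as an extended real: it is `+∞` for `τ > 1` (when `n ≥ 1`) and `-∞` for `τ ≤ 0`. -/
noncomputable def empiricalQuantile {n : ℕ} (v : Fin n → ℝ) (τ : ℝ) : EReal :=
  sInf ((fun t : ℝ => (t : EReal)) ''
    {t : ℝ | τ * (n : ℝ) ≤ ((Finset.univ.filter fun i : Fin n => v i ≤ t).card : ℝ)})

namespace RegressionAlgorithm

variable {X : Type*} [MeasurableSpace X]

/-- The `γ`-inflated jackknife+ prediction interval at the test feature `x`, trained on `D`, with
nominal coverage level `1 - α`. -/
noncomputable def jackknifePlus (A : RegressionAlgorithm X) (α γ : ℝ) {n : ℕ}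
    (D : Fin n → X × ℝ) (x : X) : Set ℝ :=
  {y : ℝ |
    - empiricalQuantile (fun i => - A.leaveOneOut D i x + A.looResidual D i)
        ((1 - α) * (1 + 1 / (n : ℝ))) - (γ : EReal) ≤ (y : EReal) ∧
    (y : EReal) ≤ empiricalQuantile (fun i => A.leaveOneOut D i x + A.looResidual D i)
        ((1 - α) * (1 + 1 / (n : ℝ))) + (γ : EReal)}

/-- The training-conditional miscoverage rate of the `γ`-inflated jackknife+ interval: the
probability, over a new point `(x, y) ∼ P` with the training data `D` held fixed, that `y` is not
in the interval at `x`. -/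
noncomputable def jackknifePlusMiscoverage (A : RegressionAlgorithm X) (P : Measure (X × ℝ))
    (α γ : ℝ) {n : ℕ} (D : Fin n → X × ℝ) : ENNReal :=
  P {z : X × ℝ | z.2 ∉ A.jackknifePlus α γ D z.1}

/-- Out-of-sample `m`-stability at sample size `n`: the expectation of `|μₙ(X) - μₙ₊ₘ(X)|`, where
`μₙ` and `μₙ₊ₘ` are fitted to the first `n`, respectively to all, of `n + m` i.i.d. points, and
`X` is the feature of a further independent point. The value `∞` is allowed. -/
noncomputable def outStability (A : RegressionAlgorithm X) (P : Measure (X × ℝ))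
    (m n : ℕ) : ENNReal :=
  ∫⁻ q : (Fin (n + m) → X × ℝ) × (X × ℝ),
    ENNReal.ofReal
      |A.fit n (fun i : Fin n => q.1 (Fin.castAdd m i)) q.2.1 - A.fit (n + m) q.1 q.2.1|
    ∂((Measure.pi fun _ : Fin (n + m) => P).prod P)

end RegressionAlgorithm

/-! Adjoin `m` fresh points to the training sample and use them to estimate the miscoverage rate. If
a fresh point is not covered, its residual against `μ₋ᵢ` exceeds `Rᵢ + γ` for at least a fraction `1
- α` of the indices `i` (`card_le_of_notMem_jackknifePlus`). Now replace every model by the one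
fitted to the enlarged sample without the point being evaluated. When the two replacements for a
pair (training point, fresh point) move the predictions by less than `γ` in total, the inflation
absorbs them and a strict comparison of enlarged-sample residuals survives
(`looResidual_lt_of_abs_sub_lt`).

Those residuals permute with the data, so only a question about ranks is left: can many fresh values
each exceed many training values? Cutting at an order statistic reduces this to two applications of
Hoeffding's inequality for sampling without replacement (`card_perm_exceed_le`,
`measure_exceed_le`), at cost `2δ`. Passing from the empirical frequency on fresh points to the true
rate costs another `δ` (`measure_prod_empirical_add_le`).

The cube root balances the bad pairs. Let each pair be bad with probability at most `c ^ 3`. By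
Markov, outside probability `c` at most a fraction `c ^ 2` of pairs is bad, and then at most a
fraction `c` of the fresh points has more than a fraction `c` of bad partners. This shifts the level
from `α` to `α + c` and discards a further fraction `c` of fresh points, whence `2 * c`. -/

/-! ### Scalar preliminaries: Hoeffding's lemma and order statistics. -/

/-- The moment generating function of a Bernoulli variable is sub-Gaussian. -/
lemma bernoulli_mgf_le {p : ℝ} (hp0 : 0 ≤ p) (hp1 : p ≤ 1) (l : ℝ) :
    1 + p * (Real.exp l - 1) ≤ Real.exp (p * l + l ^ 2 / 8) := by
  -- The two-point law with mass `p` at `1`; Hoeffding's lemma for variables in `[0, 1]` supplies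
  -- the constant `1 / 8`.
  let μ : Measure ℝ := ENNReal.ofReal (1 - p) • Measure.dirac 0 + ENNReal.ofReal p • Measure.dirac 1
  have hμ : IsProbabilityMeasure μ := ⟨by
    simp only [μ, Measure.coe_add, Measure.coe_smul, Pi.add_apply, Pi.smul_apply, measure_univ,
      smul_eq_mul, mul_one]
    rw [← ENNReal.ofReal_add (by linarith) hp0]
    simp⟩
  have hint : ∀ f : ℝ → ℝ, ∫ x, f x ∂μ = (1 - p) * f 0 + p * f 1 := by
    intro f
    have h0 : Integrable f (ENNReal.ofReal (1 - p) • Measure.dirac (0 : ℝ)) :=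
      (integrable_dirac (by simp)).smul_measure ENNReal.ofReal_ne_top
    have h1 : Integrable f (ENNReal.ofReal p • Measure.dirac (1 : ℝ)) :=
      (integrable_dirac (by simp)).smul_measure ENNReal.ofReal_ne_top
    simp only [μ]
    rw [integral_add_measure h0 h1, integral_smul_measure, integral_smul_measure]
    simp [ENNReal.toReal_ofReal, hp0, hp1]
  have hb : ∀ᵐ x ∂μ, (id x : ℝ) ∈ Set.Icc (0 : ℝ) 1 := by
    simp only [μ, ae_add_measure_iff]
    constructor <;> refine Measure.ae_smul_measure ?_ _ <;> simp
  have h := (ProbabilityTheory.hasSubgaussianMGF_of_mem_Icc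
    (μ := μ) (X := id) aemeasurable_id hb).mgf_le l
  rw [ProbabilityTheory.mgf, hint, hint] at h
  have e0 : Real.exp (l * (0 - p)) = Real.exp (-(p * l)) := by ring_nf
  have e1 : Real.exp (l * (1 - p)) = Real.exp (-(p * l)) * Real.exp l := by
    rw [← Real.exp_add]; ring_nf
  simp only [id, mul_zero, mul_one, zero_add, e0, e1] at h
  have h2 : Real.exp (-(p * l)) * (1 + p * (Real.exp l - 1)) ≤ Real.exp (l ^ 2 / 8) := by
    calc _ = (1 - p) * Real.exp (-(p * l)) + p * (Real.exp (-(p * l)) * Real.exp l) := by ring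
      _ ≤ _ := h
      _ = _ := by norm_num; ring
  calc 1 + p * (Real.exp l - 1)
      = Real.exp (p * l) * (Real.exp (-(p * l)) * (1 + p * (Real.exp l - 1))) := by
        rw [← mul_assoc, ← Real.exp_add]; simp
    _ ≤ Real.exp (p * l) * Real.exp (l ^ 2 / 8) := by gcongr
    _ = _ := by rw [← Real.exp_add]

/-- Order-statistic cut: at most `b` values lie strictly below it and at most
`card ι - b - 1` strictly above. -/
lemma exists_order_statistic {ι : Type*} [Fintype ι] (r : ι → ℝ) {b : ℕ} (hb : b < Fintype.card ι) :
    ∃ q : ℝ, (Finset.univ.filter fun i => r i < q).card ≤ b ∧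
      (Finset.univ.filter fun i => q < r i).card + b + 1 ≤ Fintype.card ι := by
  -- The cut is the smallest value with more than `b` values at or below it.
  have hne : (Finset.univ.filter fun k => b < (Finset.univ.filter fun i => r i ≤ r k).card).Nonempty := by
    have : Nonempty ι := Fintype.card_pos_iff.1 (by omega)
    obtain ⟨k, -, hk⟩ := Finset.exists_max_image (Finset.univ : Finset ι) r Finset.univ_nonempty
    refine ⟨k, ?_⟩
    simp only [Finset.mem_filter, Finset.mem_univ, true_and]
    rwa [Finset.filter_true_of_mem fun i _ => hk i (Finset.mem_univ i), Finset.card_univ]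
  obtain ⟨k, hk, hmin⟩ := Finset.exists_min_image _ r hne
  simp only [Finset.mem_filter, Finset.mem_univ, true_and] at hk hmin
  refine ⟨r k, ?_, ?_⟩
  · by_contra! h
    have hne' : (Finset.univ.filter fun i => r i < r k).Nonempty :=
      Finset.card_pos.1 (by omega)
    obtain ⟨j, hj, hmax⟩ := Finset.exists_max_image _ r hne'
    simp only [Finset.mem_filter, Finset.mem_univ, true_and] at hj hmax
    refine absurd (hmin j (h.trans_le (Finset.card_le_card fun i hi => ?_))) (not_le.2 hj)
    simp only [Finset.mem_filter, Finset.mem_univ, true_and] at hi ⊢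
    exact hmax i hi
  · have h := Finset.card_filter_add_card_filter_not (s := (Finset.univ : Finset ι)) (fun i => r i ≤ r k)
    simp only [not_le, Finset.card_univ] at h
    omega

/-! ### Sampling without replacement by uniform permutations. -/

section Permutations

variable {ι : Type*} [Fintype ι] [DecidableEq ι]

/-- Proportion of permutations mapping `K` into `T`. -/
lemma card_perm_mapsTo_le {p : ℝ} (hp0 : 0 ≤ p) (hp1 : p ≤ 1) (T : Finset ι)
    (hT : (T.card : ℝ) ≤ p * Fintype.card ι) (K : Finset ι) :
    ((Finset.univ.filter fun σ : Equiv.Perm ι => ∀ i ∈ K, σ i ∈ T).card : ℝ)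
      ≤ p ^ K.card * (Fintype.card ι).factorial := by
  induction K using Finset.induction_on with
  | empty => simp [Fintype.card_perm]
  | insert j K hj ih =>
    set H : Finset ι → Finset (Equiv.Perm ι) :=
      fun K => Finset.univ.filter fun σ : Equiv.Perm ι => ∀ i ∈ K, σ i ∈ T with hH
    change ((H (insert j K)).card : ℝ) ≤ _
    change ((H K).card : ℝ) ≤ _ at ih
    -- Composing with a transposition shows that the count does not depend on which new index joins
    -- `K`.
    have hsym : ∀ j' ∈ Kᶜ, (H (insert j' K)).card = (H (insert j K)).card := by
      intro j' hj'
      rw [Finset.mem_compl] at hj'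
      refine Finset.card_bij (fun σ _ => σ * Equiv.swap j j') ?_ ?_ ?_
      · intro σ hσ
        simp only [hH, Finset.mem_filter, Finset.mem_univ, true_and, Finset.mem_insert,
          forall_eq_or_imp, Equiv.Perm.mul_apply, Equiv.swap_apply_left] at hσ ⊢
        refine ⟨hσ.1, fun i hi => ?_⟩
        rw [Equiv.swap_apply_of_ne_of_ne (by rintro rfl; exact hj hi) (by rintro rfl; exact hj' hi)]
        exact hσ.2 i hi
      · intro σ _ τ _ h
        exact mul_right_cancel h
      · intro σ hσ
        refine ⟨σ * Equiv.swap j j', ?_, by simp [mul_assoc]⟩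
        simp only [hH, Finset.mem_filter, Finset.mem_univ, true_and, Finset.mem_insert,
          forall_eq_or_imp, Equiv.Perm.mul_apply, Equiv.swap_apply_right] at hσ ⊢
        refine ⟨hσ.1, fun i hi => ?_⟩
        rw [Equiv.swap_apply_of_ne_of_ne (by rintro rfl; exact hj hi) (by rintro rfl; exact hj' hi)]
        exact hσ.2 i hi
    have hcount : ∀ σ ∈ H K, (Kᶜ.filter fun i => σ i ∈ T).card + K.card = T.card := by
      intro σ hσ
      simp only [hH, Finset.mem_filter, Finset.mem_univ, true_and] at hσ
      have h1 : (Finset.univ.filter fun i => σ i ∈ T).card = T.card := by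
        rw [← Finset.card_map σ.toEmbedding]
        congr 1
        ext x
        simp only [Finset.mem_map, Finset.mem_filter, Finset.mem_univ, true_and,
          Equiv.coe_toEmbedding]
        exact ⟨fun ⟨a, ha, e⟩ => e ▸ ha, fun hx => ⟨σ.symm x, by simpa using hx, by simp⟩⟩
      rw [← h1, ← Finset.card_union_of_disjoint]
      · congr 1
        ext i
        simp only [Finset.mem_union, Finset.mem_filter, Finset.mem_compl, Finset.mem_univ, true_and]
        by_cases hi : i ∈ K
        · simp [hi, hσ i hi]
        · simp [hi]
      · rw [Finset.disjoint_left]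
        intro i hi
        simpa using (Finset.mem_filter.1 hi).1
    -- Double counting of pairs (permutation, new index sent into `T`): a permutation in `H K` has
    -- used `K.card` elements of `T`, so the rest of `T` is hit from outside `K`.
    have hdouble : (Kᶜ.card * (H (insert j K)).card : ℝ)
        = (H K).card * ((T.card : ℝ) - K.card) := by
      have h1 : ∑ j' ∈ Kᶜ, (H (insert j' K)).card
          = ∑ σ ∈ H K, (Kᶜ.filter fun i => σ i ∈ T).card := by
        refine Eq.trans ?_ (Finset.sum_card_bipartiteAbove_eq_sum_card_bipartiteBelow
          (s := H K) (t := Kᶜ) fun (σ : Equiv.Perm ι) i => σ i ∈ T).symm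
        refine Finset.sum_congr rfl fun j' _ => ?_
        congr 1
        ext σ
        simp [hH, Finset.bipartiteBelow, and_comm]
      rw [Finset.sum_congr rfl hsym, Finset.sum_const, smul_eq_mul] at h1
      have h2 : ((Kᶜ.card * (H (insert j K)).card : ℕ) : ℝ) = _ := congrArg Nat.cast h1
      push_cast at h2
      rw [h2, ← nsmul_eq_mul, ← Finset.sum_const]
      refine Finset.sum_congr rfl fun σ hσ => ?_
      rw [← hcount σ hσ]
      push_cast
      ring
    have hKN : (Kᶜ.card : ℝ) = Fintype.card ι - K.card := by
      rw [Finset.card_compl, Nat.cast_sub (Finset.card_le_univ K)]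
    have hpos : (0 : ℝ) < Kᶜ.card := by
      exact_mod_cast Finset.card_pos.2 ⟨j, by simpa using hj⟩
    -- Without replacement the success ratio only drops, since `p ≤ 1`.
    have hle : (T.card : ℝ) - K.card ≤ p * Kᶜ.card := by
      rw [hKN]
      nlinarith [Nat.cast_nonneg (α := ℝ) K.card]
    rw [Finset.card_insert_of_notMem hj]
    refine le_of_mul_le_mul_left ?_ hpos
    calc (Kᶜ.card : ℝ) * (H (insert j K)).card = (H K).card * ((T.card : ℝ) - K.card) := hdouble
      _ ≤ (H K).card * (p * Kᶜ.card) := by gcongr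
      _ ≤ (p ^ K.card * (Fintype.card ι).factorial) * (p * Kᶜ.card) := by gcongr
      _ = _ := by ring

/-- Hoeffding's bound on the moment generating function for sampling without replacement. -/
lemma sum_perm_exp_card_le {p : ℝ} (hp0 : 0 ≤ p) (hp1 : p ≤ 1) (T : Finset ι)
    (hT : (T.card : ℝ) ≤ p * Fintype.card ι) (S : Finset ι) {l : ℝ} (hl : 0 ≤ l) :
    ∑ σ : Equiv.Perm ι, Real.exp (l * (S.filter fun i => σ i ∈ T).card)
      ≤ (Fintype.card ι).factorial * (1 + p * (Real.exp l - 1)) ^ S.card := by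
  set u := Real.exp l - 1 with hu
  have hu0 : 0 ≤ u := by
    have := Real.one_le_exp hl
    linarith
  -- Expanding `∏ (1 + u * 1[σ i ∈ T])` over subsets; as `u ≥ 0`, the subset bounds add up to the
  -- binomial moment generating function.
  have hexp : ∀ σ : Equiv.Perm ι, Real.exp (l * (S.filter fun i => σ i ∈ T).card)
      = ∑ K ∈ S.powerset, u ^ K.card * (if ∀ i ∈ K, σ i ∈ T then 1 else 0) := by
    intro σ
    rw [mul_comm, Real.exp_nat_mul, ← Finset.prod_const, Finset.prod_filter]
    have : ∀ i ∈ S, (if σ i ∈ T then Real.exp l else 1) = 1 + u * (if σ i ∈ T then 1 else 0) := by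
      intro i _
      split_ifs <;> simp [hu]
    rw [Finset.prod_congr rfl this, Finset.prod_one_add]
    refine Finset.sum_congr rfl fun K _ => ?_
    rw [Finset.prod_mul_distrib, Finset.prod_const, Finset.prod_ite_zero]
    simp
  simp_rw [hexp]
  rw [Finset.sum_comm]
  calc _ ≤ ∑ K ∈ S.powerset, u ^ K.card * (p ^ K.card * (Fintype.card ι).factorial) := by
        refine Finset.sum_le_sum fun K _ => ?_
        rw [← Finset.mul_sum, Finset.sum_boole]
        exact mul_le_mul_of_nonneg_left (card_perm_mapsTo_le hp0 hp1 T hT K) (by positivity)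
    _ = _ := by
        have h := Finset.prod_one_add (ι := ι) (R := ℝ) (f := fun _ => p * u) S
        rw [Finset.prod_const] at h
        rw [h, Finset.mul_sum]
        refine Finset.sum_congr rfl fun K _ => ?_
        rw [Finset.prod_const, mul_pow]
        ring

/-- Hoeffding's inequality for sampling without replacement. -/
lemma card_perm_tail_le {p : ℝ} (hp0 : 0 ≤ p) (hp1 : p ≤ 1) (T : Finset ι)
    (hT : (T.card : ℝ) ≤ p * Fintype.card ι) (S : Finset ι) {t : ℝ} (ht : 0 ≤ t) :
    ((Finset.univ.filter fun σ : Equiv.Perm ι =>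
        (p + t) * S.card ≤ ((S.filter fun i => σ i ∈ T).card : ℝ)).card : ℝ)
      ≤ Real.exp (-2 * S.card * t ^ 2) * (Fintype.card ι).factorial := by
  -- Minimises the Chernoff exponent `l ^ 2 / 8 - l * t`, with value `-2 * t ^ 2`.
  set l := 4 * t with hl
  have h1 := sum_perm_exp_card_le hp0 hp1 T hT S (l := l) (by positivity)
  have h2 : ((Finset.univ.filter fun σ : Equiv.Perm ι =>
        (p + t) * S.card ≤ ((S.filter fun i => σ i ∈ T).card : ℝ)).card : ℝ)
        * Real.exp (l * ((p + t) * S.card))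
      ≤ ∑ σ : Equiv.Perm ι, Real.exp (l * (S.filter fun i => σ i ∈ T).card) := by
    rw [← nsmul_eq_mul, ← Finset.sum_const]
    refine (Finset.sum_le_sum fun σ hσ => ?_).trans
      (Finset.sum_le_sum_of_subset_of_nonneg (Finset.filter_subset _ _)
        fun _ _ _ => (Real.exp_pos _).le)
    have := (Finset.mem_filter.1 hσ).2
    gcongr
  have h3 : (1 + p * (Real.exp l - 1)) ^ S.card ≤ Real.exp (S.card * (p * l + l ^ 2 / 8)) := by
    rw [Real.exp_nat_mul]
    refine pow_le_pow_left₀ ?_ (bernoulli_mgf_le hp0 hp1 l) _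
    have := Real.exp_pos l
    nlinarith
  refine le_of_mul_le_mul_right ?_ (Real.exp_pos (l * ((p + t) * S.card)))
  calc _ ≤ _ := h2
    _ ≤ _ := h1
    _ ≤ (Fintype.card ι).factorial * Real.exp (S.card * (p * l + l ^ 2 / 8)) := by gcongr
    _ = _ := by
      rw [mul_right_comm, ← Real.exp_add, mul_comm]
      congr 2
      rw [hl]
      ring

end Permutations

/-! ### Rank comparisons for exchangeable vectors, and empirical frequencies. -/

section Exchangeable

variable {ι : Type*} [Fintype ι]

/-- The proportion of permutations for which too many of the values indexed by `S₂` exceed too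
many of the values indexed by `S₁`. -/
lemma card_perm_exceed_le [DecidableEq ι] (r : ι → ℝ) (S₁ S₂ : Finset ι) (hS₂ : S₂.Nonempty)
    {a s δ : ℝ} (ha : 0 ≤ a) (hs : 0 < s) (hδ : 0 ≤ δ)
    (h₁ : Real.exp (-2 * S₁.card * s ^ 2) ≤ δ) (h₂ : Real.exp (-2 * S₂.card * s ^ 2) ≤ δ) :
    ((Finset.univ.filter fun σ : Equiv.Perm ι => (a + 2 * s) * S₂.card ≤
        ((S₂.filter fun j => (1 - a) * S₁.card ≤
          ((S₁.filter fun i => r (σ i) < r (σ j)).card : ℝ)).card : ℝ)).card : ℝ)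
      ≤ 2 * δ * (Fintype.card ι).factorial := by
  have hm : (0 : ℝ) < S₂.card := by exact_mod_cast hS₂.card_pos
  -- In this case the event asks for more than `S₂.card` elements of `S₂`.
  by_cases has : 1 < a + s
  · rw [Finset.filter_false_of_mem]
    · simp only [Finset.card_empty, Nat.cast_zero]
      positivity
    · intro σ _ h
      have h' := h.trans (Nat.cast_le.2 (Finset.card_filter_le S₂ _))
      nlinarith
  push Not at has
  have hN : 0 < Fintype.card ι := Fintype.card_pos_iff.2 ⟨hS₂.choose⟩
  have hN' : (0 : ℝ) < Fintype.card ι := by exact_mod_cast hN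
  have hx : 0 ≤ (1 - a - s) * Fintype.card ι := mul_nonneg (by linarith) hN'.le
  -- The cut leaves at most a fraction `1 - a - s` below and `a + s` above, so each of the two tail
  -- bounds has slack `s`.
  set b := ⌊(1 - a - s) * Fintype.card ι⌋₊ with hb
  have hb1 : (b : ℝ) ≤ (1 - a - s) * Fintype.card ι := Nat.floor_le hx
  have hb2 : (1 - a - s) * Fintype.card ι < b + 1 := Nat.lt_floor_add_one _
  have hbN : b < Fintype.card ι := by
    have : (b : ℝ) < Fintype.card ι := by nlinarith
    exact_mod_cast this
  obtain ⟨q, hB, hT⟩ := exists_order_statistic r hbN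
  set B := Finset.univ.filter fun i => r i < q
  set T := Finset.univ.filter fun i => q < r i
  have hB' : (B.card : ℝ) ≤ (1 - a - s) * Fintype.card ι := le_trans (by exact_mod_cast hB) hb1
  have hT' : (T.card : ℝ) ≤ (a + s) * Fintype.card ι := by
    have : ((T.card + b + 1 : ℕ) : ℝ) ≤ Fintype.card ι := by exact_mod_cast hT
    push_cast at this
    linarith
  have tB := card_perm_tail_le (by linarith) (by linarith) B hB' S₁ hs.le
  have tT := card_perm_tail_le (by linarith) has T hT' S₂ hs.le
  set F₁ := Finset.univ.filter fun σ : Equiv.Perm ι =>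
    (1 - a - s + s) * S₁.card ≤ ((S₁.filter fun i => σ i ∈ B).card : ℝ)
  set F₂ := Finset.univ.filter fun σ : Equiv.Perm ι =>
    (a + s + s) * S₂.card ≤ ((S₂.filter fun i => σ i ∈ T).card : ℝ)
  have hsub : (Finset.univ.filter fun σ : Equiv.Perm ι => (a + 2 * s) * S₂.card ≤
        ((S₂.filter fun j => (1 - a) * S₁.card ≤
          ((S₁.filter fun i => r (σ i) < r (σ j)).card : ℝ)).card : ℝ)) ⊆ F₁ ∪ F₂ := by
    intro σ hσ
    simp only [Finset.mem_filter, Finset.mem_univ, true_and, Finset.mem_union, F₁, F₂] at hσ ⊢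
    by_contra! hcon
    have hle : (S₂.filter fun j => (1 - a) * S₁.card ≤
          ((S₁.filter fun i => r (σ i) < r (σ j)).card : ℝ)).card
        ≤ (S₂.filter fun i => σ i ∈ T).card := by
      refine Finset.card_le_card fun j hj => ?_
      rw [Finset.mem_filter] at hj ⊢
      refine ⟨hj.1, ?_⟩
      by_contra hjT
      -- An index not above the cut can only beat indices strictly below it, and `S₁` contains too
      -- few of these.
      have hjq : r (σ j) ≤ q := by simpa [T] using hjT
      have : (S₁.filter fun i => r (σ i) < r (σ j)).card ≤ (S₁.filter fun i => σ i ∈ B).card := by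
        refine Finset.card_le_card fun i hi => ?_
        rw [Finset.mem_filter] at hi ⊢
        exact ⟨hi.1, by simpa [B] using hi.2.trans_le hjq⟩
      have h1 := hj.2.trans (Nat.cast_le.2 this)
      have h2 := hcon.1
      rw [sub_add_cancel] at h2
      linarith
    have h1 := hσ.trans (Nat.cast_le.2 hle)
    have h2 := hcon.2
    rw [add_assoc, ← two_mul] at h2
    linarith
  calc _ ≤ ((F₁ ∪ F₂).card : ℝ) := by exact_mod_cast Finset.card_le_card hsub
    _ ≤ F₁.card + F₂.card := by exact_mod_cast Finset.card_union_le _ _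
    _ ≤ δ * (Fintype.card ι).factorial + δ * (Fintype.card ι).factorial := by
        refine add_le_add (tB.trans ?_) (tT.trans ?_) <;> gcongr
    _ = _ := by ring

variable {Z : Type*} [MeasurableSpace Z] (P : Measure Z) [IsProbabilityMeasure P]

lemma measurePreserving_comp_equiv {κ : Type*} [Fintype κ] (e : κ ≃ ι) :
    MeasurePreserving (fun (ω : ι → Z) (k : κ) => ω (e k))
      (Measure.pi fun _ => P) (Measure.pi fun _ => P) := by
  convert measurePreserving_piCongrLeft (α := fun _ : κ => Z) (fun _ => P) e.symm using 1
  ext ω k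
  simp [MeasurableEquiv.piCongrLeft, Equiv.piCongrLeft, Equiv.piCongrLeft']

/-- A bound on the proportion of permutations is a bound on the probability for an exchangeable
vector. -/
lemma measure_preimage_le_of_card_perm_le [DecidableEq ι] {F : (ι → Z) → ι → ℝ} (hF : Measurable F)
    (hFe : ∀ (σ : Equiv.Perm ι) ω, F (fun i => ω (σ i)) = fun i => F ω (σ i))
    {E : Set (ι → ℝ)} (hE : MeasurableSet E) [DecidablePred (· ∈ E)] {C : ℝ}
    (hC : ∀ r : ι → ℝ, ((Finset.univ.filter fun σ : Equiv.Perm ι => (fun i => r (σ i)) ∈ E).card : ℝ)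
      ≤ C * (Fintype.card ι).factorial) :
    (Measure.pi fun _ : ι => P) (F ⁻¹' E) ≤ ENNReal.ofReal C := by
  set μ := Measure.pi fun _ : ι => P
  have hN : (0 : ℝ) < (Fintype.card ι).factorial := by exact_mod_cast Nat.factorial_pos _
  -- Average over all permutations: each preimage has the same measure, and under the integral the
  -- sum is the permutation count for the fixed vector `F ω`.
  have key : ((Fintype.card ι).factorial : ENNReal) * μ (F ⁻¹' E)
      ≤ (Fintype.card ι).factorial * ENNReal.ofReal C := by
    calc ((Fintype.card ι).factorial : ENNReal) * μ (F ⁻¹' E)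
        = ∑ σ : Equiv.Perm ι, μ ((fun (ω : ι → Z) i => ω (σ i)) ⁻¹' (F ⁻¹' E)) := by
          rw [Finset.sum_congr rfl fun σ _ =>
            (measurePreserving_comp_equiv P σ).measure_preimage (hF hE).nullMeasurableSet]
          simp [Fintype.card_perm, μ]
      _ = ∑ σ : Equiv.Perm ι, ∫⁻ ω, (if (fun i => F ω (σ i)) ∈ E then 1 else 0) ∂μ := by
          refine Finset.sum_congr rfl fun σ _ => ?_
          rw [← lintegral_indicator_one ((measurePreserving_comp_equiv P σ).measurable (hF hE))]
          refine lintegral_congr fun ω => ?_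
          have h : ω ∈ (fun (ω : ι → Z) i => ω (σ i)) ⁻¹' (F ⁻¹' E) ↔ (fun i => F ω (σ i)) ∈ E := by
            rw [Set.mem_preimage, Set.mem_preimage, hFe]
          by_cases h' : (fun i => F ω (σ i)) ∈ E
          · rw [Set.indicator_of_mem (h.2 h'), if_pos h', Pi.one_apply]
          · rw [Set.indicator_of_notMem (mt h.1 h'), if_neg h']
      _ = ∫⁻ ω, ∑ σ : Equiv.Perm ι, (if (fun i => F ω (σ i)) ∈ E then 1 else 0) ∂μ := by
          rw [lintegral_finsetSum]
          intro σ _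
          refine Measurable.ite ?_ measurable_const measurable_const
          exact (measurable_pi_lambda _ fun i => (measurable_pi_apply (σ i)).comp hF) hE
      _ ≤ ∫⁻ _, ((Fintype.card ι).factorial * ENNReal.ofReal C) ∂μ := by
          refine lintegral_mono fun ω => ?_
          rw [Finset.sum_boole, mul_comm, ← ENNReal.ofReal_natCast, ← ENNReal.ofReal_natCast,
            ← ENNReal.ofReal_mul' hN.le]
          exact ENNReal.ofReal_le_ofReal (hC (F ω))
      _ = _ := by simp [μ]
  refine (ENNReal.mul_le_mul_iff_right ?_ ?_).1 key
  · exact_mod_cast (Nat.factorial_pos _).ne'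
  · exact ENNReal.natCast_ne_top _

lemma measurable_card_filter {Ω κ : Type*} [MeasurableSpace Ω] (S : Finset κ) (p : Ω → κ → Prop)
    [∀ ω, DecidablePred (p ω)] (hp : ∀ k ∈ S, MeasurableSet {ω | p ω k}) :
    Measurable fun ω => ((S.filter (p ω)).card : ℝ) := by
  classical
  have : (fun ω => ((S.filter (p ω)).card : ℝ)) = fun ω => ∑ k ∈ S, {ω | p ω k}.indicator 1 ω := by
    ext ω
    rw [Finset.card_filter]
    push_cast
    refine Finset.sum_congr rfl fun k _ => ?_
    simp [Set.indicator_apply]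
  rw [this]
  exact Finset.measurable_sum _ fun k hk => measurable_one.indicator (hp k hk)

/-- For an exchangeable vector, it is unlikely that too many of the values indexed by `S₂` exceed
too many of the values indexed by `S₁`. -/
lemma measure_exceed_le [DecidableEq ι] {F : (ι → Z) → ι → ℝ} (hF : Measurable F)
    (hFe : ∀ (σ : Equiv.Perm ι) ω, F (fun i => ω (σ i)) = fun i => F ω (σ i))
    (S₁ S₂ : Finset ι) (hS₂ : S₂.Nonempty)
    {a s δ : ℝ} (ha : 0 ≤ a) (hs : 0 < s) (hδ : 0 ≤ δ)
    (h₁ : Real.exp (-2 * S₁.card * s ^ 2) ≤ δ) (h₂ : Real.exp (-2 * S₂.card * s ^ 2) ≤ δ) :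
    (Measure.pi fun _ : ι => P) {ω | (a + 2 * s) * S₂.card ≤
        ((S₂.filter fun j => (1 - a) * S₁.card ≤
          ((S₁.filter fun i => F ω i < F ω j).card : ℝ)).card : ℝ)}
      ≤ 2 * ENNReal.ofReal δ := by
  classical
  rw [show (2 : ENNReal) = ENNReal.ofReal 2 by simp, ← ENNReal.ofReal_mul (by norm_num)]
  refine measure_preimage_le_of_card_perm_le P hF hFe (E := {r | (a + 2 * s) * S₂.card ≤
        ((S₂.filter fun j => (1 - a) * S₁.card ≤
          ((S₁.filter fun i => r i < r j).card : ℝ)).card : ℝ)}) ?_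
    fun r => card_perm_exceed_le r S₁ S₂ hS₂ ha hs hδ h₁ h₂
  refine measurableSet_le measurable_const (measurable_card_filter S₂ _ fun j _ => ?_)
  refine measurableSet_le measurable_const (measurable_card_filter S₁ _ fun i _ => ?_)
  exact measurableSet_lt (measurable_pi_apply i) (measurable_pi_apply j)

/-- Hoeffding's inequality for the empirical frequency of an event. -/
lemma measure_empirical_add_le [Nonempty ι] {U : Set Z} (hU : MeasurableSet U)
    [DecidablePred (· ∈ U)] {s : ℝ} (hs : 0 ≤ s) :
    (Measure.pi fun _ : ι => P) {W | ((Finset.univ.filter fun j => W j ∈ U).card : ℝ)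
        + s * Fintype.card ι ≤ P.real U * Fintype.card ι}
      ≤ ENNReal.ofReal (Real.exp (-2 * Fintype.card ι * s ^ 2)) := by
  set μ := Measure.pi fun _ : ι => P
  let f : Z → ℝ := U.indicator 1
  have hf : Measurable f := measurable_one.indicator hU
  have hfint : ∫ z, f z ∂P = P.real U := integral_indicator_one hU
  -- The sign is chosen for the tail in which the frequency underestimates the probability.
  let Y : ι → (ι → Z) → ℝ := fun j W => P.real U - f (W j)
  have hind : ProbabilityTheory.iIndepFun Y μ :=
    ProbabilityTheory.iIndepFun_pi (X := fun _ z => P.real U - f z)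
      fun _ => (measurable_const.sub hf).aemeasurable
  have hsub : ∀ j ∈ Finset.univ, ProbabilityTheory.HasSubgaussianMGF (Y j) ((‖(1 : ℝ) - 0‖₊ / 2) ^ 2) μ := by
    intro j _
    have h0 : ProbabilityTheory.HasSubgaussianMGF (fun z => f z - P.real U)
        ((‖(1 : ℝ) - 0‖₊ / 2) ^ 2) P := by
      rw [← hfint]
      refine ProbabilityTheory.hasSubgaussianMGF_of_mem_Icc hf.aemeasurable (.of_forall fun z => ?_)
      by_cases hz : z ∈ U <;> simp [f, hz]
    have hmp : MeasurePreserving (Function.eval j) μ P := measurePreserving_eval (fun _ => P) j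
    have h1 := ProbabilityTheory.HasSubgaussianMGF.of_map (Y := Function.eval j) (μ := μ)
      hmp.aemeasurable (X := fun z => f z - P.real U) (by rw [hmp.map_eq]; exact h0)
    convert h1.neg using 1
    ext W
    simp [Y]
  have hN : (0 : ℝ) < Fintype.card ι := by exact_mod_cast Fintype.card_pos
  have h := ProbabilityTheory.HasSubgaussianMGF.measure_sum_ge_le_of_iIndepFun hind hsub
    (ε := s * Fintype.card ι) (by positivity)
  have hexp : -(s * (Fintype.card ι : ℝ)) ^ 2
      / (2 * ((∑ _j : ι, (‖(1 : ℝ) - 0‖₊ / 2) ^ 2 : NNReal) : ℝ)) = -2 * Fintype.card ι * s ^ 2 := by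
    simp
    field_simp
  have h' := ENNReal.ofReal_le_ofReal (h.trans_eq (congrArg Real.exp hexp))
  rw [ofReal_measureReal] at h'
  refine le_trans (measure_mono fun W hW => ?_) h'
  simp only [Set.mem_ofPred_eq, Y, Finset.sum_sub_distrib, Finset.sum_const, Finset.card_univ,
    nsmul_eq_mul] at hW ⊢
  have : ∑ j, f (W j) = ((Finset.univ.filter fun j => W j ∈ U).card : ℝ) := by
    rw [Finset.card_filter]
    push_cast
    refine Finset.sum_congr rfl fun k _ => ?_
    simp [f, Set.indicator_apply]
  rw [this]
  linarith

end Exchangeable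

/-! ### Miscoverage, symmetry and stability for leave-one-out fits. -/

lemma card_le_of_empiricalQuantile_lt {n : ℕ} {v : Fin n → ℝ} {τ y : ℝ}
    (h : empiricalQuantile v τ < (y : EReal)) :
    τ * n ≤ ((Finset.univ.filter fun i => v i < y).card : ℝ) := by
  obtain ⟨_, ⟨t, ht, rfl⟩, hty⟩ := sInf_lt_iff.1 h
  have hty' : t < y := EReal.coe_lt_coe_iff.1 hty
  change τ * n ≤ ((Finset.univ.filter fun i => v i ≤ t).card : ℝ) at ht
  refine ht.trans ?_
  exact_mod_cast Finset.card_le_card fun i hi => by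
    simp only [Finset.mem_filter, Finset.mem_univ, true_and] at hi ⊢
    exact hi.trans_lt hty'

namespace RegressionAlgorithm

variable {X : Type*} [MeasurableSpace X] (A : RegressionAlgorithm X)

/-- A point outside of the inflated jackknife+ interval has a large residual in comparison with
many of the leave-one-out residuals. -/
lemma card_le_of_notMem_jackknifePlus {α γ : ℝ} (hα : α ≤ 1) {n : ℕ} (hn : 1 ≤ n)
    {D : Fin n → X × ℝ} {x : X} {y : ℝ} (h : y ∉ A.jackknifePlus α γ D x) :
    (1 - α) * n ≤ ((Finset.univ.filter fun i =>
      A.looResidual D i + γ < |y - A.leaveOneOut D i x|).card : ℝ) := by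
  have hn' : (0 : ℝ) < n := by exact_mod_cast hn
  -- The factor `1 + 1 / n` yields a surplus `1 - α ≥ 0`, which is discarded.
  have hτ : (1 - α) * n ≤ (1 - α) * (1 + 1 / (n : ℝ)) * n := by
    have : (1 - α) * (1 + 1 / (n : ℝ)) * n = (1 - α) * n + (1 - α) := by field_simp
    linarith
  refine hτ.trans ?_
  by_cases hu : (y : EReal) ≤ empiricalQuantile (fun i => A.leaveOneOut D i x + A.looResidual D i)
        ((1 - α) * (1 + 1 / (n : ℝ))) + (γ : EReal)
  · have hl : ¬ (- empiricalQuantile (fun i => - A.leaveOneOut D i x + A.looResidual D i)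
        ((1 - α) * (1 + 1 / (n : ℝ))) - (γ : EReal) ≤ (y : EReal)) := fun hl => h ⟨hl, hu⟩
    rw [not_le, EReal.lt_sub_iff_add_lt (.inl (EReal.coe_ne_bot _)) (.inl (EReal.coe_ne_top _)),
      EReal.lt_neg_comm, ← EReal.coe_add, ← EReal.coe_neg] at hl
    refine (card_le_of_empiricalQuantile_lt hl).trans ?_
    exact_mod_cast Finset.card_le_card fun i hi => by
      simp only [Finset.mem_filter, Finset.mem_univ, true_and] at hi ⊢
      have := neg_abs_le (y - A.leaveOneOut D i x)
      linarith
  · rw [not_le, ← EReal.lt_sub_iff_add_lt (.inl (EReal.coe_ne_bot _)) (.inl (EReal.coe_ne_top _)),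
      ← EReal.coe_sub] at hu
    refine (card_le_of_empiricalQuantile_lt hu).trans ?_
    exact_mod_cast Finset.card_le_card fun i hi => by
      simp only [Finset.mem_filter, Finset.mem_univ, true_and] at hi ⊢
      have := le_abs_self (y - A.leaveOneOut D i x)
      linarith

variable {A}

/-- Two enumerations of the same index set differ by a permutation, so a fit depends only on the set
of points used. -/
lemma IsSymmetric.fit_comp_eq (hA : A.IsSymmetric) {κ : Type*} {n : ℕ} {g h : Fin n → κ}
    (hg : g.Injective) (hh : h.Injective) (hgh : Set.range g = Set.range h) (ω : κ → X × ℝ) :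
    A.fit n (fun j => ω (g j)) = A.fit n (fun j => ω (h j)) := by
  let σ : Equiv.Perm (Fin n) := (Equiv.ofInjective g hg).trans
    ((Equiv.setCongr hgh).trans (Equiv.ofInjective h hh).symm)
  have hσ : ∀ j, h (σ j) = g j := fun j => by
    simp only [σ, Equiv.trans_apply, Equiv.apply_ofInjective_symm]
    rfl
  rw [← hA n σ (fun j => ω (h j))]
  simp_rw [hσ]

/-- Permuting the data permutes the residuals, because `σ` carries the complement of `k` onto that
of `σ k`. This equivariance makes the residual vector exchangeable. -/
lemma IsSymmetric.looResidual_comp_perm (hA : A.IsSymmetric) {n : ℕ}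
    (σ : Equiv.Perm (Fin (n + 1))) (ω : Fin (n + 1) → X × ℝ) :
    A.looResidual (fun i => ω (σ i)) = fun i => A.looResidual ω (σ i) := by
  ext k
  have h := hA.fit_comp_eq (g := fun j => σ (k.succAbove j)) (h := (σ k).succAbove)
    (σ.injective.comp k.succAbove_right_injective) (σ k).succAbove_right_injective ?_ ω
  · simp only [looResidual, leaveOneOut, h]
  · rw [show (fun j => σ (k.succAbove j)) = σ ∘ k.succAbove from rfl, Set.range_comp,
      Fin.range_succAbove, Fin.range_succAbove, Set.image_compl_eq σ.bijective, Set.image_singleton]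

variable (A)

lemma measurable_fit_comp {Ω : Type*} [MeasurableSpace Ω] {n : ℕ} {D : Ω → Fin n → X × ℝ}
    (hD : Measurable D) {x : Ω → X} (hx : Measurable x) :
    Measurable fun ω => A.fit n (D ω) (x ω) :=
  (A.measurable_fit n).comp (hD.prodMk hx)

lemma measurable_leaveOneOut_comp {Ω : Type*} [MeasurableSpace Ω] {n : ℕ}
    {D : Ω → Fin (n + 1) → X × ℝ} (hD : Measurable D) {x : Ω → X} (hx : Measurable x)
    (i : Fin (n + 1)) : Measurable fun ω => A.leaveOneOut (D ω) i (x ω) :=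
  A.measurable_fit_comp (D := fun ω j => D ω (i.succAbove j))
    (measurable_pi_lambda _ fun _ => (measurable_pi_apply _).comp hD) hx

lemma measurable_looResidual {n : ℕ} :
    Measurable fun D : Fin (n + 1) → X × ℝ => A.looResidual D := by
  refine measurable_pi_lambda _ fun i => ?_
  exact ((measurable_snd.comp (measurable_pi_apply i)).sub (A.measurable_leaveOneOut_comp
    measurable_id (measurable_fst.comp (measurable_pi_apply i)) i)).abs

variable {A}

/-- Out-of-sample stability between any `n` of the points other than `k` and all of the points
other than `k`, at the point `k`. -/
lemma IsSymmetric.lintegral_abs_fit_sub (hA : A.IsSymmetric) (P : Measure (X × ℝ))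
    [IsProbabilityMeasure P] {n m : ℕ} (k : Fin (n + m + 1)) {g : Fin n → Fin (n + m + 1)}
    (hg : g.Injective) (hgk : ∀ i, g i ≠ k) :
    ∫⁻ ω, ENNReal.ofReal |A.fit n (fun i => ω (g i)) (ω k).1 - A.leaveOneOut ω k (ω k).1|
      ∂(Measure.pi fun _ => P) = A.outStability P m n := by
  choose g' hg' using fun i => Fin.exists_succAbove_eq (hgk i)
  have hg'inj : g'.Injective := fun i j hij => hg (by rw [← hg', ← hg', hij])
  -- Reordering the points other than `k` so that the chosen `n` come first turns the integral into
  -- the one defining `outStability`.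
  obtain ⟨e, he⟩ : ∃ e : Equiv.Perm (Fin (n + m)), ∀ i, e (Fin.castAdd m i) = g' i := by
    have hf : ∀ i, Function.extend (Fin.castAdd m) g' id (Fin.castAdd m i) = g' i :=
      fun i => (Fin.castAdd_injective n m).extend_apply _ _ i
    obtain ⟨e, he⟩ := Set.MapsTo.exists_equiv_extend_of_card_eq
      (α := Fin (n + m)) (t := (Finset.univ : Finset (Fin (n + m)))) (by simp)
      (s := Set.range (Fin.castAdd m)) (f := Function.extend (Fin.castAdd m) g' id)
      (fun _ _ => by simp)
      (by rintro _ ⟨i, rfl⟩ _ ⟨j, rfl⟩ hij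
          rw [hf, hf] at hij
          rw [hg'inj hij])
    refine ⟨e.trans (Equiv.subtypeUnivEquiv fun _ => Finset.mem_univ _), fun i => ?_⟩
    rw [← hf, ← he _ ⟨i, rfl⟩]
    rfl
  have hmp : MeasurePreserving (fun (ω : Fin (n + m + 1) → X × ℝ) =>
      ((fun j => ω (k.succAbove (e j))), ω k)) (Measure.pi fun _ => P)
      ((Measure.pi fun _ => P).prod P) :=
    ((measurePreserving_comp_equiv P e).prod (MeasurePreserving.id P)).comp
      (Measure.measurePreserving_swap.comp (measurePreserving_piFinSuccAbove (fun _ => P) k))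
  rw [outStability, ← hmp.lintegral_comp]
  · refine lintegral_congr fun ω => ?_
    have h := hA.fit_comp_eq (g := fun j => k.succAbove (e j)) (h := k.succAbove)
      (k.succAbove_right_injective.comp e.injective) k.succAbove_right_injective
      (e.surjective.range_comp k.succAbove) ω
    simp only [he, hg', h, leaveOneOut]
  · refine (Measurable.abs (Measurable.sub ?_ ?_)).ennreal_ofReal
    · exact A.measurable_fit_comp (by fun_prop) (by fun_prop)
    · exact A.measurable_fit_comp (by fun_prop) (by fun_prop)

end RegressionAlgorithm

/-! ### Counting bad pairs by Markov's inequality. -/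

/-- If each of finitely many events has probability at most `c ^ 3`, then with probability at least
`1 - c` at most a fraction `c ^ 2` of them occur. -/
lemma measure_card_gt_le {Ω κ : Type*} [MeasurableSpace Ω] [Fintype κ] (μ : Measure Ω)
    (p : Ω → κ → Prop) [∀ ω, DecidablePred (p ω)] (hp : ∀ k, MeasurableSet {ω | p ω k})
    {c : ℝ} (hc : 0 ≤ c) (h : ∀ k, μ {ω | p ω k} ≤ ENNReal.ofReal (c ^ 3)) :
    μ {ω | c ^ 2 * Fintype.card κ < ((Finset.univ.filter (p ω)).card : ℝ)} ≤ ENNReal.ofReal c := by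
  classical
  -- For `c = 0` Markov's threshold vanishes; here every event is null and a union bound suffices.
  rcases hc.eq_or_lt with rfl | hc
  · refine (measure_mono (t := ⋃ k, {ω | p ω k}) fun ω hω => ?_).trans
      ((measure_iUnion_le _).trans ?_)
    · have hω' : (0 : ℝ) < ((Finset.univ.filter (p ω)).card : ℝ) := by simpa using hω
      obtain ⟨k, hk⟩ := Finset.card_pos.1 (Nat.cast_pos.1 hω')
      exact Set.mem_iUnion.2 ⟨k, (Finset.mem_filter.1 hk).2⟩
    · rw [tsum_fintype]
      refine (Finset.sum_le_sum fun k _ => h k).trans ?_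
      simp
  rcases isEmpty_or_nonempty κ with hκ | hκ
  · simp
  have hN : (0 : ℝ) < Fintype.card κ := by exact_mod_cast Fintype.card_pos
  have hint : ∫⁻ ω, ENNReal.ofReal ((Finset.univ.filter (p ω)).card : ℝ) ∂μ
      ≤ Fintype.card κ * ENNReal.ofReal (c ^ 3) := by
    have : ∀ ω, ENNReal.ofReal ((Finset.univ.filter (p ω)).card : ℝ)
        = ∑ k, {ω | p ω k}.indicator 1 ω := by
      intro ω
      rw [ENNReal.ofReal_natCast, Finset.card_filter]
      push_cast
      refine Finset.sum_congr rfl fun k _ => ?_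
      simp [Set.indicator_apply]
    simp_rw [this]
    rw [lintegral_finsetSum _ fun k _ => measurable_one.indicator (hp k)]
    simp_rw [lintegral_indicator_one (hp _)]
    refine (Finset.sum_le_sum fun k _ => h k).trans ?_
    simp
  have hmarkov := mul_meas_ge_le_lintegral (μ := μ)
    (measurable_card_filter Finset.univ p fun k _ => hp k).ennreal_ofReal
    (ENNReal.ofReal (c ^ 2 * Fintype.card κ))
  have hfac : (Fintype.card κ : ENNReal) * ENNReal.ofReal (c ^ 3)
      = ENNReal.ofReal (c ^ 2 * Fintype.card κ) * ENNReal.ofReal c := by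
    rw [← ENNReal.ofReal_natCast, ← ENNReal.ofReal_mul hN.le, ← ENNReal.ofReal_mul (by positivity)]
    ring_nf
  refine (ENNReal.mul_le_mul_iff_right ?_ ENNReal.ofReal_ne_top).1
    (le_trans ?_ ((hmarkov.trans hint).trans_eq hfac))
  · exact (ENNReal.ofReal_pos.2 (by positivity)).ne'
  · exact mul_le_mul_right (measure_mono fun ω hω => ENNReal.ofReal_le_ofReal hω.le) _

/-- Counting form of the comparison of two relations which agree outside of few bad pairs. -/
lemma card_filter_le_of_few_bad {κ₁ κ₂ : Type*} [Fintype κ₁] [Fintype κ₂]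
    (big less bad : κ₁ → κ₂ → Prop)
    [∀ i, DecidablePred (big i)] [∀ i, DecidablePred (less i)] [∀ i, DecidablePred (bad i)]
    (himp : ∀ i j, big i j → ¬ bad i j → less i j) {a c : ℝ} (hc : 0 ≤ c)
    (hbad : ((Finset.univ.filter fun q : κ₁ × κ₂ => bad q.1 q.2).card : ℝ)
      ≤ c ^ 2 * Fintype.card (κ₁ × κ₂)) :
    ((Finset.univ.filter fun j => (1 - a) * Fintype.card κ₁
        ≤ ((Finset.univ.filter fun i => big i j).card : ℝ)).card : ℝ)
      ≤ ((Finset.univ.filter fun j => (1 - (a + c)) * Fintype.card κ₁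
        ≤ ((Finset.univ.filter fun i => less i j).card : ℝ)).card : ℝ) + c * Fintype.card κ₂ := by
  classical
  -- The columns with more than a fraction `c` of bad entries; more than a fraction `c` of such
  -- columns would break the `c ^ 2` budget.
  set J := Finset.univ.filter fun j => c * Fintype.card κ₁
    < ((Finset.univ.filter fun i => bad i j).card : ℝ) with hJ
  have hsum : ((Finset.univ.filter fun q : κ₁ × κ₂ => bad q.1 q.2).card : ℝ)
      = ∑ j, ((Finset.univ.filter fun i => bad i j).card : ℝ) := by
    simp_rw [Finset.card_filter]
    push_cast
    rw [Fintype.sum_prod_type_right]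
  have hJcard : (J.card : ℝ) ≤ c * Fintype.card κ₂ := by
    by_contra! hlt
    have hJne : J.Nonempty := by
      rw [← Finset.card_pos, ← Nat.cast_pos (α := ℝ)]
      exact lt_of_le_of_lt (by positivity) hlt
    have h1 : ∑ _j ∈ J, c * Fintype.card κ₁ < ∑ j ∈ J, ((Finset.univ.filter fun i => bad i j).card : ℝ) :=
      Finset.sum_lt_sum_of_nonempty hJne fun j hj => (Finset.mem_filter.1 hj).2
    have h2 : ∑ j ∈ J, ((Finset.univ.filter fun i => bad i j).card : ℝ)
        ≤ ∑ j, ((Finset.univ.filter fun i => bad i j).card : ℝ) :=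
      Finset.sum_le_sum_of_subset_of_nonneg (Finset.subset_univ _) fun _ _ _ => by positivity
    rw [Finset.sum_const, nsmul_eq_mul] at h1
    rw [hsum, Fintype.card_prod] at hbad
    push_cast at hbad
    have h3 : c * Fintype.card κ₂ * (c * Fintype.card κ₁) ≤ J.card * (c * Fintype.card κ₁) := by
      gcongr
    nlinarith
  have hsub : (Finset.univ.filter fun j => (1 - a) * Fintype.card κ₁
        ≤ ((Finset.univ.filter fun i => big i j).card : ℝ))
      ⊆ (Finset.univ.filter fun j => (1 - (a + c)) * Fintype.card κ₁
        ≤ ((Finset.univ.filter fun i => less i j).card : ℝ)) ∪ J := by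
    intro j hj
    simp only [Finset.mem_filter, Finset.mem_univ, true_and, Finset.mem_union, hJ] at hj ⊢
    by_contra! hcon
    have hle : (Finset.univ.filter fun i => big i j).card
        ≤ (Finset.univ.filter fun i => less i j).card + (Finset.univ.filter fun i => bad i j).card := by
      refine le_trans (Finset.card_le_card fun i hi => ?_) (Finset.card_union_le _ _)
      simp only [Finset.mem_filter, Finset.mem_univ, true_and, Finset.mem_union] at hi ⊢
      by_cases hb : bad i j
      · exact .inr hb
      · exact .inl (himp i j hi hb)
    have hle' : ((Finset.univ.filter fun i => big i j).card : ℝ)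
        ≤ (Finset.univ.filter fun i => less i j).card + (Finset.univ.filter fun i => bad i j).card := by
      exact_mod_cast hle
    linarith [hcon.1, hcon.2]
  calc _ ≤ (((Finset.univ.filter fun j => (1 - (a + c)) * Fintype.card κ₁
        ≤ ((Finset.univ.filter fun i => less i j).card : ℝ)) ∪ J).card : ℝ) := by
          exact_mod_cast Finset.card_le_card hsub
    _ ≤ _ := by
      refine le_trans (by exact_mod_cast Finset.card_union_le _ _) (add_le_add le_rfl hJcard)

/-! ### Passing to the enlarged sample. -/

namespace RegressionAlgorithm

variable {X : Type*} [MeasurableSpace X] {A : RegressionAlgorithm X}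

/-- If the leave-one-out models change little when the sample is enlarged, then a residual that
exceeds a leave-one-out residual by `γ` still exceeds it for the enlarged sample. -/
lemma looResidual_lt_of_abs_sub_lt {n N : ℕ} {D : Fin n → X × ℝ} {ω : Fin N → X × ℝ} {γ : ℝ}
    {i : Fin n} {k l : Fin N} (hk : D i = ω k)
    (h : A.looResidual D i + γ < |(ω l).2 - A.leaveOneOut D i (ω l).1|)
    (hγ : |A.leaveOneOut D i (ω l).1 - A.leaveOneOut ω l (ω l).1|
      + |A.leaveOneOut D i (ω k).1 - A.leaveOneOut ω k (ω k).1| < γ) :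
    A.looResidual ω k < A.looResidual ω l := by
  unfold looResidual at *
  rw [hk] at h
  have h1 := abs_sub_le (ω l).2 (A.leaveOneOut ω l (ω l).1) (A.leaveOneOut D i (ω l).1)
  have h2 := abs_sub_le (ω k).2 (A.leaveOneOut D i (ω k).1) (A.leaveOneOut ω k (ω k).1)
  rw [abs_sub_comm (A.leaveOneOut ω l (ω l).1)] at h1
  linarith

/-- The probability that the leave-one-out models change by `γ` when the sample is enlarged. -/
lemma IsSymmetric.measure_abs_sub_ge_le (hA : A.IsSymmetric) (P : Measure (X × ℝ))
    [IsProbabilityMeasure P] {n m : ℕ} {γ : ℝ} (hγ : 0 < γ) {g : Fin (n + 1) → Fin (n + m + 1)}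
    (hg : g.Injective) (i : Fin (n + 1)) {l : Fin (n + m + 1)} (hl : ∀ i, g i ≠ l) :
    MeasurableSet {ω : Fin (n + m + 1) → X × ℝ |
      γ ≤ |A.leaveOneOut (fun i => ω (g i)) i (ω l).1 - A.leaveOneOut ω l (ω l).1|
        + |A.leaveOneOut (fun i => ω (g i)) i (ω (g i)).1
            - A.leaveOneOut ω (g i) (ω (g i)).1|} ∧
    (Measure.pi fun _ => P) {ω : Fin (n + m + 1) → X × ℝ |
      γ ≤ |A.leaveOneOut (fun i => ω (g i)) i (ω l).1 - A.leaveOneOut ω l (ω l).1|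
        + |A.leaveOneOut (fun i => ω (g i)) i (ω (g i)).1
            - A.leaveOneOut ω (g i) (ω (g i)).1|}
      ≤ 2 * A.outStability P m n / ENNReal.ofReal γ := by
  have hm : ∀ k : Fin (n + m + 1), Measurable fun ω : Fin (n + m + 1) → X × ℝ =>
      |A.leaveOneOut (fun i => ω (g i)) i (ω k).1 - A.leaveOneOut ω k (ω k).1| := fun k =>
    ((A.measurable_leaveOneOut_comp (by fun_prop) (by fun_prop) i).sub
      (A.measurable_leaveOneOut_comp measurable_id (by fun_prop) k)).abs
  have hβ : ∀ k, (∀ j, g (i.succAbove j) ≠ k) →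
      ∫⁻ ω, ENNReal.ofReal
        |A.leaveOneOut (fun i => ω (g i)) i (ω k).1 - A.leaveOneOut ω k (ω k).1|
      ∂(Measure.pi fun _ => P) = A.outStability P m n := fun k hk =>
    hA.lintegral_abs_fit_sub P k (g := fun j => g (i.succAbove j))
      (hg.comp i.succAbove_right_injective) hk
  refine ⟨measurableSet_le measurable_const ((hm l).add (hm (g i))), ?_⟩
  have h := meas_ge_le_lintegral_div (μ := Measure.pi fun _ : Fin (n + m + 1) => P)
    (((hm l).add (hm (g i))).ennreal_ofReal).aemeasurable
    (ENNReal.ofReal_pos.2 hγ).ne' ENNReal.ofReal_ne_top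
  refine (measure_mono fun ω hω => ENNReal.ofReal_le_ofReal hω).trans (h.trans_eq ?_)
  congr 1
  -- Each of the two differences compares a fit on `n` points with one on `n + m`, at a point in
  -- neither, so each integrates to the stability: hence the factor `2`.
  simp_rw [Pi.add_apply, ENNReal.ofReal_add (abs_nonneg _) (abs_nonneg _)]
  rw [lintegral_add_left (hm l).ennreal_ofReal, hβ l fun j => hl _,
    hβ (g i) fun j h => i.succAbove_ne j (hg h), two_mul]

end RegressionAlgorithm

/-! ### Assembling the bound. -/

/-- An event for independent samples whose sections are all unlikely is unlikely. -/
lemma measure_prod_empirical_add_le {Y Z κ : Type*} [MeasurableSpace Y] [MeasurableSpace Z]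
    [Fintype κ] [Nonempty κ] (π : Measure Y) [IsProbabilityMeasure π] (P : Measure Z)
    [IsProbabilityMeasure P] (p : Y → Z → Prop) [∀ y, DecidablePred (p y)]
    (hp : MeasurableSet {q : Y × Z | p q.1 q.2}) {s : ℝ} (hs : 0 ≤ s) :
    (π.prod (Measure.pi fun _ : κ => P)) {q |
        ((Finset.univ.filter fun j => p q.1 (q.2 j)).card : ℝ) + s * Fintype.card κ
          ≤ P.real {z | p q.1 z} * Fintype.card κ}
      ≤ ENNReal.ofReal (Real.exp (-2 * Fintype.card κ * s ^ 2)) := by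
  rw [Measure.prod_apply]
  · calc _ ≤ ∫⁻ _, ENNReal.ofReal (Real.exp (-2 * Fintype.card κ * s ^ 2)) ∂π :=
        lintegral_mono fun y => measure_empirical_add_le P
          (U := {z | p y z}) (measurable_prodMk_left hp) hs
      _ = _ := by simp
  · refine measurableSet_le ((measurable_card_filter _ _ fun j _ => ?_).add measurable_const)
      (Measurable.mul_const ?_ _)
    · have h : Measurable fun q : Y × (κ → Z) => (q.1, q.2 j) := by fun_prop
      exact h hp
    · exact ((measurable_measure_prodMk_left hp).comp measurable_fst).ennreal_toReal

/-- The square root solves `exp (-2 * a * s ^ 2) = δ`, and a larger `N` only helps; with `a = min n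
m` this serves both sample sizes. -/
lemma exp_neg_two_mul_sq_sqrt_le {δ a N : ℝ} (hδ0 : 0 < δ) (hδ1 : δ < 1) (ha : 0 < a)
    (haN : a ≤ N) : Real.exp (-2 * N * Real.sqrt (Real.log (1 / δ) / (2 * a)) ^ 2) ≤ δ := by
  have hlog : 0 < Real.log (1 / δ) := Real.log_pos (by rw [lt_div_iff₀ hδ0]; linarith)
  rw [Real.sq_sqrt (by positivity), ← Real.le_log_iff_exp_le hδ0]
  have h1 : Real.log δ = - Real.log (1 / δ) := by simp
  rw [h1]
  have h2 : -2 * N * (Real.log (1 / δ) / (2 * a)) = - (N / a * Real.log (1 / δ)) := by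
    field_simp
  rw [h2, neg_le_neg_iff]
  exact le_mul_of_one_le_left hlog.le ((one_le_div ha).2 haN)

namespace RegressionAlgorithm

variable {X : Type*} [MeasurableSpace X] {A : RegressionAlgorithm X}

/-- The training-conditional miscoverage bound in terms of a real bound on the stability. -/
lemma IsSymmetric.measure_compl_miscoverage_lt_le (hA : A.IsSymmetric) (P : Measure (X × ℝ))
    [IsProbabilityMeasure P] {α : ℝ} (hα0 : 0 ≤ α) (hα1 : α ≤ 1) (n : ℕ) {γ : ℝ} (hγ : 0 < γ)
    {m : ℕ} (hm : 1 ≤ m) {s δ c : ℝ} (hs : 0 < s) (hδ : 0 ≤ δ) (hc : 0 ≤ c)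
    (hsn : Real.exp (-2 * (n + 1 : ℕ) * s ^ 2) ≤ δ) (hsm : Real.exp (-2 * m * s ^ 2) ≤ δ)
    (hβ : 2 * A.outStability P m n / ENNReal.ofReal γ ≤ ENNReal.ofReal (c ^ 3)) :
    (Measure.pi fun _ : Fin (n + 1) => P) {D : Fin (n + 1) → X × ℝ |
        A.jackknifePlusMiscoverage P α γ D < ENNReal.ofReal (α + 3 * s + 2 * c)}ᶜ
      ≤ 3 * ENNReal.ofReal δ + ENNReal.ofReal c := by
  classical
  have : Nonempty (Fin m) := ⟨⟨0, hm⟩⟩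
  have hm0 : (0 : ℝ) < m := by exact_mod_cast hm
  -- There are `n + 1` training points, so leave-one-out fits use `n` points before and `n + m`
  -- after enlargement.
  let e : Fin (n + 1) ⊕ Fin m ≃ Fin (n + m + 1) := finSumFinEquiv.trans (finCongr (by omega))
  let g : Fin (n + 1) → Fin (n + m + 1) := fun i => e (.inl i)
  let l : Fin m → Fin (n + m + 1) := fun j => e (.inr j)
  have hg : g.Injective := e.injective.comp Sum.inl_injective
  have hl : l.Injective := e.injective.comp Sum.inr_injective
  have hgl : ∀ i j, g i ≠ l j := fun i j h => by simpa using e.injective h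
  let π := Measure.pi fun _ : Fin (n + 1) => P
  let ν := Measure.pi fun _ : Fin m => P
  let μ := Measure.pi fun _ : Fin (n + m + 1) => P
  let Φ : (Fin (n + 1) → X × ℝ) × (Fin m → X × ℝ) → Fin (n + m + 1) → X × ℝ :=
    fun q k => (MeasurableEquiv.sumPiEquivProdPi fun _ : Fin (n + 1) ⊕ Fin m => X × ℝ).symm q
      (e.symm k)
  have hΦ : MeasurePreserving Φ (π.prod ν) μ :=
    (measurePreserving_comp_equiv P e.symm).comp (measurePreserving_sumPiEquivProdPi_symm fun _ => P)
  have hΦg : ∀ q i, Φ q (g i) = q.1 i := fun q i => by simp [Φ, g, MeasurableEquiv.sumPiEquivProdPi]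
  have hΦl : ∀ q j, Φ q (l j) = q.2 j := fun q j => by simp [Φ, l, MeasurableEquiv.sumPiEquivProdPi]
  let big : (Fin (n + 1) → X × ℝ) → X × ℝ → Fin (n + 1) → Prop := fun D z i =>
    A.looResidual D i + γ < |z.2 - A.leaveOneOut D i z.1|
  -- A measurable event containing the non-coverage event, whose own measurability is then not
  -- needed.
  let U : (Fin (n + 1) → X × ℝ) → X × ℝ → Prop := fun D z =>
    (1 - α) * (n + 1 : ℕ) ≤ ((Finset.univ.filter (big D z)).card : ℝ)
  have hU : MeasurableSet {q : (Fin (n + 1) → X × ℝ) × (X × ℝ) | U q.1 q.2} := by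
    refine measurableSet_le measurable_const (measurable_card_filter Finset.univ
      (fun q : (Fin (n + 1) → X × ℝ) × (X × ℝ) => big q.1 q.2) fun i _ => ?_)
    refine measurableSet_lt (Measurable.add_const ?_ _) (Measurable.abs (Measurable.sub ?_ ?_))
    · exact (measurable_pi_apply i).comp (A.measurable_looResidual.comp measurable_fst)
    · fun_prop
    · exact A.measurable_leaveOneOut_comp measurable_fst (by fun_prop) i
  let bad : (Fin (n + m + 1) → X × ℝ) → Fin (n + 1) → Fin m → Prop := fun ω i j =>
    γ ≤ |A.leaveOneOut (fun i => ω (g i)) i (ω (l j)).1 - A.leaveOneOut ω (l j) (ω (l j)).1|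
        + |A.leaveOneOut (fun i => ω (g i)) i (ω (g i)).1 - A.leaveOneOut ω (g i) (ω (g i)).1|
  let less : (Fin (n + m + 1) → X × ℝ) → Fin (n + 1) → Fin m → Prop := fun ω i j =>
    A.looResidual ω (g i) < A.looResidual ω (l j)
  let B₁ : Set (Fin (n + m + 1) → X × ℝ) := {ω | c ^ 2 * Fintype.card (Fin (n + 1) × Fin m)
    < ((Finset.univ.filter fun q : Fin (n + 1) × Fin m => bad ω q.1 q.2).card : ℝ)}
  let B₂ : Set (Fin (n + m + 1) → X × ℝ) := {ω | (α + c + 2 * s) * m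
    ≤ ((Finset.univ.filter fun j => (1 - (α + c)) * (n + 1 : ℕ)
      ≤ ((Finset.univ.filter fun i => less ω i j).card : ℝ)).card : ℝ)}
  have hB₁ : μ B₁ ≤ ENNReal.ofReal c := by
    refine measure_card_gt_le μ (fun ω (q : Fin (n + 1) × Fin m) => bad ω q.1 q.2)
      (fun q => ?_) hc fun q => ?_
    · exact (hA.measure_abs_sub_ge_le P hγ hg q.1 fun i => hgl i q.2).1
    · exact (hA.measure_abs_sub_ge_le P hγ hg q.1 fun i => hgl i q.2).2.trans hβ
  have hB₂ : μ B₂ ≤ 2 * ENNReal.ofReal δ := by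
    have h := measure_exceed_le P A.measurable_looResidual (fun σ ω => hA.looResidual_comp_perm σ ω)
      (Finset.univ.map ⟨g, hg⟩) (Finset.univ.map ⟨l, hl⟩) (Finset.univ_nonempty.map)
      (a := α + c) (s := s) (δ := δ) (by positivity) hs hδ (by simpa using hsn) (by simpa using hsm)
    simpa only [Finset.filter_map, Finset.card_map, Finset.card_univ, Fintype.card_fin] using! h
  let H : Set ((Fin (n + 1) → X × ℝ) × (Fin m → X × ℝ)) := {q |
        ((Finset.univ.filter fun j => U q.1 (q.2 j)).card : ℝ) + s * Fintype.card (Fin m)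
          ≤ P.real {z | U q.1 z} * Fintype.card (Fin m)}
  have hH : (π.prod ν) H ≤ ENNReal.ofReal δ := by
    refine (measure_prod_empirical_add_le π P U hU hs.le).trans (ENNReal.ofReal_le_ofReal ?_)
    simpa using hsm
  set G := {D : Fin (n + 1) → X × ℝ |
        A.jackknifePlusMiscoverage P α γ D < ENNReal.ofReal (α + 3 * s + 2 * c)}
  -- Outside the exceptional events the rate is below `(α + c + 2 * s) + c + s`: ranks, bad columns,
  -- empirical error.
  have hsub : Gᶜ ×ˢ (Set.univ : Set (Fin m → X × ℝ)) ⊆ H ∪ Φ ⁻¹' (B₁ ∪ B₂) := by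
    intro q hq
    by_contra hcon
    simp only [Set.mem_union, Set.mem_preimage, not_or] at hcon
    obtain ⟨h1, h2, h3⟩ := hcon
    replace h1 : P.real {z | U q.1 z} * Fintype.card (Fin m)
        < ((Finset.univ.filter fun j => U q.1 (q.2 j)).card : ℝ) + s * Fintype.card (Fin m) :=
      lt_of_not_ge h1
    replace h2 : ((Finset.univ.filter fun k : Fin (n + 1) × Fin m => bad (Φ q) k.1 k.2).card : ℝ)
        ≤ c ^ 2 * Fintype.card (Fin (n + 1) × Fin m) := le_of_not_gt h2
    replace h3 : ((Finset.univ.filter fun j => (1 - (α + c)) * (n + 1 : ℕ)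
        ≤ ((Finset.univ.filter fun i => less (Φ q) i j).card : ℝ)).card : ℝ)
        < (α + c + 2 * s) * m := lt_of_not_ge h3
    have hD : (fun i => Φ q (g i)) = q.1 := funext fun i => hΦg q i
    have hcount := card_filter_le_of_few_bad (fun i j => big q.1 (q.2 j) i) (less (Φ q)) (bad (Φ q))
      (fun i j hb hnb => ?_) (a := α) hc h2
    · simp only [Fintype.card_fin] at hcount h1
      have hlt : P.real {z | U q.1 z} < α + 3 * s + 2 * c := by
        refine lt_of_mul_lt_mul_right ?_ hm0.le
        change ((Finset.univ.filter fun j => U q.1 (q.2 j)).card : ℝ) ≤ _ at hcount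
        linarith
      refine hq.1 (lt_of_le_of_lt (measure_mono fun z hz => ?_)
        ((ENNReal.lt_ofReal_iff_toReal_lt (measure_ne_top P {z | U q.1 z})).2 hlt))
      exact A.card_le_of_notMem_jackknifePlus hα1 (by omega) hz
    · have hnb' := not_le.1 hnb
      rw [hD] at hnb'
      refine looResidual_lt_of_abs_sub_lt (hΦg q i).symm ?_ hnb'
      rw [hΦl]
      exact hb
  calc π Gᶜ = (π.prod ν) (Gᶜ ×ˢ Set.univ) := by rw [Measure.prod_prod, measure_univ, mul_one]
    _ ≤ (π.prod ν) H + (π.prod ν) (Φ ⁻¹' (B₁ ∪ B₂)) :=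
        (measure_mono hsub).trans (measure_union_le _ _)
    _ ≤ (π.prod ν) H + μ (B₁ ∪ B₂) := by
        gcongr
        rw [← hΦ.map_eq]
        exact Measure.le_map_apply hΦ.aemeasurable _
    _ ≤ ENNReal.ofReal δ + (ENNReal.ofReal c + 2 * ENNReal.ofReal δ) :=
        add_le_add hH ((measure_union_le _ _).trans (add_le_add hB₁ hB₂))
    _ = _ := by ring

end RegressionAlgorithm

theorem theorem1 {X : Type*} [MeasurableSpace X]
    (P : Measure (X × ℝ)) [IsProbabilityMeasure P]
    (A : RegressionAlgorithm X) (hA : A.IsSymmetric)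
    (α : ℝ) (hα0 : 0 ≤ α) (hα1 : α ≤ 1)
    (n : ℕ) (hn : 1 ≤ n) (γ : ℝ) (hγ : 0 < γ)
    (m : ℕ) (hm : 1 ≤ m) (δ : ℝ) (hδ0 : 0 < δ) (hδ1 : δ < 1) :
    1 - 3 * ENNReal.ofReal δ
        - (2 * A.outStability P m (n - 1) / ENNReal.ofReal γ) ^ (1 / 3 : ℝ)
      ≤ (Measure.pi fun _ : Fin n => P)
          {D : Fin n → X × ℝ |
            A.jackknifePlusMiscoverage P α γ D
              < ENNReal.ofReal
                  (α + 3 * Real.sqrt (Real.log (1 / δ) / (2 * min (n : ℝ) (m : ℝ))))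
                + 2 * (2 * A.outStability P m (n - 1) / ENNReal.ofReal γ) ^ (1 / 3 : ℝ)} := by
  obtain ⟨n, rfl⟩ : ∃ k, n = k + 1 := ⟨n - 1, by omega⟩
  rw [Nat.add_sub_cancel]
  set b := 2 * A.outStability P m n / ENNReal.ofReal γ with hb
  set s := Real.sqrt (Real.log (1 / δ) / (2 * min ((n + 1 : ℕ) : ℝ) (m : ℝ))) with hs
  have hmin : 0 < min ((n + 1 : ℕ) : ℝ) (m : ℝ) :=
    lt_min (by positivity) (by exact_mod_cast hm)
  have hs0 : 0 < s := Real.sqrt_pos.2 (div_pos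
    (Real.log_pos (by rw [lt_div_iff₀ hδ0]; linarith)) (by positivity))
  -- With infinite stability the truncated subtraction makes the left side `0`.
  rcases eq_or_ne (b ^ (1 / 3 : ℝ)) ⊤ with htop | htop
  · rw [htop]
    simp
  set c := (b ^ (1 / 3 : ℝ)).toReal with hc
  have hcE : b ^ (1 / 3 : ℝ) = ENNReal.ofReal c := (ENNReal.ofReal_toReal htop).symm
  have hc0 : 0 ≤ c := ENNReal.toReal_nonneg
  have hbc : b ≤ ENNReal.ofReal (c ^ 3) := by
    rw [ENNReal.ofReal_pow hc0, ← hcE, ← ENNReal.rpow_natCast, ← ENNReal.rpow_mul]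
    norm_num
  have hmain := hA.measure_compl_miscoverage_lt_le P hα0 hα1 n hγ hm hs0 hδ0.le hc0
    (exp_neg_two_mul_sq_sqrt_le hδ0 hδ1 hmin (min_le_left _ _))
    (exp_neg_two_mul_sq_sqrt_le hδ0 hδ1 hmin (min_le_right _ _)) hbc
  rw [hcE]
  have hthr : ENNReal.ofReal (α + 3 * s) + 2 * ENNReal.ofReal c
      = ENNReal.ofReal (α + 3 * s + 2 * c) := by
    rw [ENNReal.ofReal_add (p := α + 3 * s) (by positivity) (by positivity),
      ENNReal.ofReal_mul (p := 2) (by norm_num)]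
    simp
  rw [hthr, tsub_tsub, tsub_le_iff_right]
  set G := {D : Fin (n + 1) → X × ℝ |
        A.jackknifePlusMiscoverage P α γ D < ENNReal.ofReal (α + 3 * s + 2 * c)}
  -- Subadditivity suffices, so `G` need not be measurable.
  calc (1 : ENNReal) = (Measure.pi fun _ : Fin (n + 1) => P) (G ∪ Gᶜ) := by
        rw [Set.union_compl_self, measure_univ]
    _ ≤ _ := (measure_union_le _ _).trans (add_le_add le_rfl hmain)
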